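/- Let $\mathcal V$ be a locally finite variety of algebras (of an arbitrary type) with residual bound $\kappa(\mathcal V)=N<\omega$; that is, $N$ is finite and is the least cardinal strictly larger than the cardinality of every subdirectly irreducible member of $\mathcal V$. Let $p_0,\dots,p_K$ be terms in the language of $\mathcal V$ expanded by constant symbols $\overline c=(c_1,\dots,c_n)$, and let $J(\overline c)$ be the set of Jónsson identities for the polynomials $p_i(\overline c,x,y,z)$: \begin{align*} &p_0(\overline c,x,y,z)\approx x,\qquad p_K(\overline c,x,y,z)\approx z,\qquad p_i(\overline c,x,y,x)\approx x \quad (0\le i\le K),\\ &p_i(\overline c,x,x,y)\approx p_{i+1}(\overline c,x,x,y)\quad (0\le i<K,\ i \text{ even}),\\ &p_i(\overline c,x,y,y)\approx p_{i+1}(\overline c,x,y,y)\quad (0\le i<K,\ i \text{ odd}). \end{align*} Then the class $$\mathcal M=\{\mathbb B\in\mathcal V \mid \mathbb B\models \exists \overline c\; J(\overline c)\},$$ where the identities are universally quantified in $x,y,z$ for fixed $\overline c$, has definable principal subcongruences: there are congruence formulas $\Gamma(w,x,y,z)$ and $\psi(w,x,y,z)$ such that for all $\mathbb B\in\mathcal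 M$ and all $a\ne b$ in $\mathbb B$ there exist $c\neq d$ in $\mathbb B$ such that $\mathbb B\models\Gamma(c,d,a,b)$ and $\psi(-,-,c,d)$ defines the principal congruence $\mathrm{Cg}^{\mathbb B}(c,d)$. Here a congruence formula is a finite disjunction of congruence schemes, and a congruence scheme is a first-order formula in $w,x,y,z$ which, for a fixed finite sequence of terms $f_1,\dots,f_m$, says that there are elements $k_1,\dots,k_{m+1}$ and a tuple $\overline e$ with $w=k_1$, $x=k_{m+1}$ and $\{f_i(\overline e,y),f_i(\overline e,z)\}=\{k_i,k_{i+1}\}$ for $1\le i\le m$. -/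

import Mathlib

universe u v w

namespace UnivAlg

open FirstOrder FirstOrder.Language CategoryTheory


/-! Algebras of a type (signature) are the structures of a first-order language `L` without relation
symbols (`L.IsAlgebraic`).  A class of algebras is a set of bundled `L`-structures. -/

/-- An equivalence relation on `M` is a congruence if every basic operation respects it. -/
def IsCongruence (L : FirstOrder.Language.{u, v}) {M : Type w} [L.Structure M] (θ : Setoid M) : Prop :=
  ∀ (n : ℕ) (f : L.Functions n) (x y : Fin n → M), (∀ i, θ (x i) (y i)) →
    θ (Structure.funMap f x) (Structure.funMap f y)

/-- The principal congruence `Cg(a, b)`: the least congruence that relates `a` and `b`. -/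
def Cg (L : FirstOrder.Language.{u, v}) {M : Type w} [L.Structure M] (a b : M) : Setoid M :=
  sInf {θ : Setoid M | IsCongruence L θ ∧ θ a b}

/-- `M` is subdirectly irreducible: it has a least congruence different from equality. -/
def IsSubdirectlyIrreducible (L : FirstOrder.Language.{u, v}) (M : Type w) [L.Structure M] : Prop :=
  ∃ μ : Setoid M, IsCongruence L μ ∧ μ ≠ ⊥ ∧ ∀ θ : Setoid M, IsCongruence L θ → θ ≠ ⊥ → μ ≤ θ

/-- The variety axiomatized by the set `E` of identities `s ≈ t`: all nonempty algebras in which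
every identity of `E` holds. -/
def variety {L : FirstOrder.Language.{u, v}} (E : Set (L.Term ℕ × L.Term ℕ)) :
    Set (Bundled.{w} L.Structure) :=
  {M | Nonempty M ∧ ∀ e ∈ E, ∀ x : ℕ → M, e.1.realize x = e.2.realize x}

/-- A class of algebras is locally finite if all finitely generated subalgebras of its members
are finite. -/
def LocallyFinite {L : FirstOrder.Language.{u, v}} (K : Set (Bundled.{w} L.Structure)) : Prop :=
  ∀ M ∈ K, ∀ S : L.Substructure M, S.FG → Finite S

/-- `κ(K) = lam`: the residual bound of `K` exists and is `lam`, i.e. `lam` is the least cardinal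
that is strictly larger than the cardinality of every subdirectly irreducible member of `K`. -/
def IsResidualBound {L : FirstOrder.Language.{u, v}} (K : Set (Bundled.{w} L.Structure))
    (lam : Cardinal.{w}) : Prop :=
  IsLeast {c : Cardinal.{w} | ∀ M ∈ K, IsSubdirectlyIrreducible L M → Cardinal.mk M < c} lam

/-- The data of a congruence scheme: a finite sequence of terms `f_i(e, t)`, where `e` is a tuple of
`numParams` parameters and `t` is one further variable. -/
structure CongruenceScheme (L : FirstOrder.Language.{u, v}) where
  numParams : ℕ
  length : ℕ
  term : Fin length → L.Term (Fin numParams ⊕ Unit)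

namespace CongruenceScheme

variable {L : FirstOrder.Language.{u, v}} (S : CongruenceScheme L)

/-- The free variables `w, x, y, z` (numbered `0, 1, 2, 3`), the parameters `e` and the chain `k`. -/
abbrev Vars : Type := Fin 4 ⊕ (Fin S.numParams ⊕ Fin (S.length + 1))

/-- The variable `k_j`. -/
def chainVar (j : Fin (S.length + 1)) : L.Term S.Vars :=
  Term.var (Sum.inr (Sum.inr j))

/-- The term `f_i(e, t)`, with the free variable numbered `j` for `t`. -/
def termAt (i : Fin S.length) (j : Fin 4) : L.Term S.Vars :=
  (S.term i).relabel (Sum.elim (fun p => Sum.inr (Sum.inl p)) (fun _ => Sum.inl j))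

/-- `{f_i(e, y), f_i(e, z)} = {k_i, k_{i+1}}` as a formula. -/
def link (i : Fin S.length) : L.Formula S.Vars :=
  ((S.termAt i 2).equal (S.chainVar i.castSucc) ⊓ (S.termAt i 3).equal (S.chainVar i.succ)) ⊔
    ((S.termAt i 2).equal (S.chainVar i.succ) ⊓ (S.termAt i 3).equal (S.chainVar i.castSucc))

/-- The congruence scheme as a first-order formula in `w, x, y, z`: there are `e` and `k` with
`k_0 = w`, `k_length = x` and `{f_i(e, y), f_i(e, z)} = {k_i, k_{i+1}}` for all `i < length`. -/
noncomputable def toFormula : L.Formula (Fin 4) :=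
  Formula.iExs (Fin S.numParams ⊕ Fin (S.length + 1))
    ((S.chainVar 0).equal (Term.var (Sum.inl 0)) ⊓
      ((S.chainVar (Fin.last S.length)).equal (Term.var (Sum.inl 1)) ⊓
        Formula.iInf S.link))

end CongruenceScheme

/-- A congruence formula is a finite disjunction of congruence schemes. -/
def IsCongruenceFormula {L : FirstOrder.Language.{u, v}} (φ : L.Formula (Fin 4)) : Prop :=
  ∃ l : List (CongruenceScheme L), φ = l.foldr (fun S χ => S.toFormula ⊔ χ) ⊥

/-- Definable principal subcongruences. -/
def HasDPSC {L : FirstOrder.Language.{u, v}} (K : Set (Bundled.{w} L.Structure)) : Prop :=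
  ∃ Γ ψ : L.Formula (Fin 4), IsCongruenceFormula Γ ∧ IsCongruenceFormula ψ ∧
    ∀ A ∈ K, ∀ a b : A, a ≠ b → ∃ c d : A, c ≠ d ∧ Γ.Realize ![c, d, a, b] ∧
      ∀ r s : A, ψ.Realize ![r, s, c, d] ↔ Cg L c d r s

/-- The Jónsson identities for ternary operations `p_0, …, p_k` on a set. -/
structure JonssonIdentities {M : Type w} {k : ℕ} (p : Fin (k + 1) → M → M → M → M) : Prop where
  first : ∀ x y z, p 0 x y z = x
  last : ∀ x y z, p (Fin.last k) x y z = z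
  absorb : ∀ i x y, p i x y x = x
  even : ∀ i : Fin k, Even (i : ℕ) → ∀ x y, p i.castSucc x x y = p i.succ x x y
  odd : ∀ i : Fin k, Odd (i : ℕ) → ∀ x y, p i.castSucc x y y = p i.succ x y y

/-- The ternary polynomial operation `p(c, ·, ·, ·)` of `M` given by a term `p` in `n` constant
symbols and three variables and by values `c` of the constant symbols. -/
def polyOp {L : FirstOrder.Language.{u, v}} {M : Type w} [L.Structure M] {n : ℕ}
    (p : L.Term (Fin n ⊕ Fin 3)) (c : Fin n → M) (x y z : M) : M :=
  p.realize (Sum.elim c ![x, y, z])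

/-- The algebras of `K` that satisfy `∃ c, J(c)`, with `J(c)` the Jónsson identities for the
polynomials `p_i(c, x, y, z)`. -/
def jonssonClass {L : FirstOrder.Language.{u, v}} (K : Set (Bundled.{w} L.Structure)) {n k : ℕ}
    (p : Fin (k + 1) → L.Term (Fin n ⊕ Fin 3)) : Set (Bundled.{w} L.Structure) :=
  {M | M ∈ K ∧ ∃ c : Fin n → M, JonssonIdentities fun i => polyOp (p i) c}

end UnivAlg

/-!
Let `B` be an algebra of the class, with constants that witness the Jónsson identities.  Every
subalgebra of `B` that contains these constants is congruence distributive
(`JonssonIdentities.inf_sup_le`), so in it a congruence that is maximal among those separating some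
pair is meet-prime (`IsMaxSeparating.exists_le_of_sInf_le`).  The quotients by such congruences are
subdirectly irreducible, hence have fewer than `N` elements.

Given `a ≠ b`, choose a maximal separating congruence `η` of `B` with `(a, b) ∉ η` whose quotient is
as large as possible.  Let `D` be the subalgebra generated by the constants, `a`, `b`, a pair that
`η` separates maximally, and representatives of all `η`-classes; it is finite, with a bounded number
of generators.  The restriction of `η` to `D` is again maximal separating, so by primeness there is a
pair `(c, d)` outside it that lies in each congruence of `D` not below it; in particular `(c, d)` lies
in `Cg(a, b)` computed in `D`.  A maximal separating congruence `η'` of `B` that separates `c` and `d`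
restricts to a congruence of `D` below the restriction of `η`.  As `B/η'` is no larger than `B/η`,
it follows that `D` maps onto `B/η'` (`exists_pair_cgIn`).  Consequently, if `(r, s) ∈ Cg(c, d)` in
`B`, this already holds in the subalgebra `D'` generated by `D`, `r`, `s`: otherwise some maximal
separating congruence of `D'` contains `(c, d)` but not `(r, s)`; by primeness it lies above the
restriction of some such `η'`, and since `D'` maps onto `B/η'` it extends to a congruence of `B`
(`cgIn_of_forall_surjective`).

It remains to describe principal congruences of subalgebras with a bounded number of generators.  By
local finiteness the free algebra on finitely many generators is finite, so there are finitely many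
terms up to equality in the variety (`exists_finite_terms`).  Mal'cev chains can be taken without
repetition, which bounds their length by the size of the subalgebra, and their links are unary
polynomials with the generators as parameters.  Thus finitely many congruence schemes suffice
(`exists_congruenceFormula_of_generators`).
-/

namespace UnivAlg

open FirstOrder FirstOrder.Language CategoryTheory

/-! ### Congruences -/

section Congruences

variable {L : FirstOrder.Language.{u, v}} {M : Type w} [L.Structure M]

/-- An equivalence relation is a congruence as soon as it is compatible with the basic operations
in each argument separately. -/
theorem isCongruence_of_update {θ : Setoid M}
    (h : ∀ (n : ℕ) (f : L.Functions n) (x : Fin n → M) (i : Fin n) (a b : M), θ a b →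
      θ (Structure.funMap f (Function.update x i a)) (Structure.funMap f (Function.update x i b))) :
    IsCongruence L θ := by
  classical
  intro n f x y hxy
  have key : ∀ s : Finset (Fin n),
      θ (Structure.funMap f x) (Structure.funMap f (s.piecewise y x)) := by
    intro s
    induction s using Finset.induction_on with
    | empty => simp
    | insert i s hi ih =>
      refine θ.trans ih ?_
      have h' := h n f (s.piecewise y x) i (x i) (y i) (hxy i)
      rw [Finset.piecewise_insert]
      convert h' using 2
      rw [← Finset.piecewise_eq_of_notMem s y x hi, Function.update_eq_self]
  simpa using key Finset.univ

theorem IsCongruence.update {θ : Setoid M} (hθ : IsCongruence L θ) {n : ℕ} (f : L.Functions n)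
    (x : Fin n → M) (i : Fin n) {a b : M} (hab : θ a b) :
    θ (Structure.funMap f (Function.update x i a)) (Structure.funMap f (Function.update x i b)) := by
  refine hθ n f _ _ fun j => ?_
  rcases eq_or_ne j i with rfl | hj
  · simpa using hab
  · simp [hj]

theorem IsCongruence.realize_term {θ : Setoid M} (hθ : IsCongruence L θ) {α : Type*}
    (t : L.Term α) {x y : α → M} (hxy : ∀ i, θ (x i) (y i)) : θ (t.realize x) (t.realize y) := by
  induction t with
  | var a => exact hxy a
  | func f ts ih => exact hθ _ f _ _ ih

theorem IsCongruence.bot : IsCongruence L (⊥ : Setoid M) := by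
  intro n f x y h
  have : x = y := funext h
  subst this
  exact Setoid.refl' _ _

theorem IsCongruence.sInf {S : Set (Setoid M)} (hS : ∀ θ ∈ S, IsCongruence L θ) :
    IsCongruence L (sInf S) :=
  fun n f x y h θ hθ => hS θ hθ n f x y fun i => h i θ hθ

theorem IsCongruence.sup {α β : Setoid M} (hα : IsCongruence L α) (hβ : IsCongruence L β) :
    IsCongruence L (α ⊔ β) := by
  refine isCongruence_of_update fun n f x i a b hab => ?_
  have hle : α ⊔ β ≤ Setoid.comap (fun c => Structure.funMap f (Function.update x i c)) (α ⊔ β) :=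
    sup_le (fun a b h => (le_sup_left : α ≤ α ⊔ β) (hα.update f x i h))
      (fun a b h => (le_sup_right : β ≤ α ⊔ β) (hβ.update f x i h))
  exact hle hab

theorem isCongruence_Cg (a b : M) : IsCongruence L (Cg L a b) :=
  IsCongruence.sInf fun _ h => h.1

theorem Cg_self (a b : M) : Cg L a b a b := fun _ h => h.2

theorem Cg_le {θ : Setoid M} (hθ : IsCongruence L θ) {a b : M} (h : θ a b) : Cg L a b ≤ θ :=
  sInf_le ⟨hθ, h⟩

theorem isCongruence_comap {P : Type*} [L.Structure P] (φ : M →[L] P) {θ : Setoid P}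
    (hθ : IsCongruence L θ) : IsCongruence L (θ.comap φ) := by
  intro n f x y h
  change θ (φ _) (φ _)
  rw [φ.map_fun, φ.map_fun]
  exact hθ n f _ _ h

/-- Homomorphisms carry principal congruences into principal congruences. -/
theorem Cg_map {P : Type*} [L.Structure P] (φ : M →[L] P) {a b r s : M} (h : Cg L a b r s) :
    Cg L (φ a) (φ b) (φ r) (φ s) :=
  Cg_le (isCongruence_comap φ (isCongruence_Cg (φ a) (φ b))) (Cg_self (φ a) (φ b)) h

/-! ### Distributivity from Jónsson operations -/

/-- Equivalence relations that are compatible with a sequence of Jónsson operations satisfy the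
distributive law. -/
theorem JonssonIdentities.inf_sup_le {k : ℕ} {p : Fin (k + 1) → M → M → M → M}
    (hp : JonssonIdentities p) {γ δ ε : Setoid M}
    (hγ : ∀ i x z {u v}, γ u v → γ (p i x z u) (p i x z v))
    (hδ : ∀ i x y {u v}, δ u v → δ (p i x u y) (p i x v y))
    (hε : ∀ i x y {u v}, ε u v → ε (p i x u y) (p i x v y)) :
    γ ⊓ (δ ⊔ ε) ≤ (γ ⊓ δ) ⊔ (γ ⊓ ε) := by
  rintro x y ⟨hxy, hxy'⟩
  -- all elements `p i x z y` lie in one class of `γ`, because `p i x z x = x`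
  have hcls : ∀ i z z', γ (p i x z y) (p i x z' y) := fun i z z' => by
    have h : ∀ z, γ (p i x z y) x := fun z => by
      have := hγ i x z (γ.symm hxy)
      rwa [hp.absorb] at this
    exact γ.trans (h z) (γ.symm (h z'))
  have hmid : ∀ i, ((γ ⊓ δ) ⊔ (γ ⊓ ε)) (p i x x y) (p i x y y) := fun i => by
    have hle : δ ⊔ ε ≤ Setoid.comap (fun z => p i x z y) ((γ ⊓ δ) ⊔ (γ ⊓ ε)) :=
      sup_le
        (fun a b h => (le_sup_left : γ ⊓ δ ≤ (γ ⊓ δ) ⊔ (γ ⊓ ε)) ⟨hcls i a b, hδ i x y h⟩)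
        (fun a b h => (le_sup_right : γ ⊓ ε ≤ (γ ⊓ δ) ⊔ (γ ⊓ ε)) ⟨hcls i a b, hε i x y h⟩)
    exact hle hxy'
  have hall : ∀ i : Fin (k + 1), ((γ ⊓ δ) ⊔ (γ ⊓ ε)) x (p i x x y) := by
    intro i
    induction i using Fin.induction with
    | zero => rw [hp.first]
    | succ i ih =>
      rcases Nat.even_or_odd (i : ℕ) with h | h
      · rwa [← hp.even i h]
      · refine Setoid.trans' _ (Setoid.trans' _ ih (hmid i.castSucc)) ?_
        rw [hp.odd i h]
        exact Setoid.symm' _ (hmid i.succ)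
  have := hall (Fin.last k)
  rwa [hp.last] at this

/-! ### Separating congruences -/

/-- The congruence `θ` is maximal among the congruences that do not relate `x` and `y`.
Maximality is stated through joins: a congruence not below `θ` brings `(x, y)` into its join with `θ`.
The quotients by such congruences are subdirectly irreducible. -/
structure IsMaxSeparating (L : FirstOrder.Language.{u, v}) {M : Type w} [L.Structure M]
    (θ : Setoid M) (x y : M) : Prop where
  isCongruence : IsCongruence L θ
  not_rel : ¬ θ x y
  rel_of_not_le : ∀ α : Setoid M, IsCongruence L α → ¬ α ≤ θ → (θ ⊔ α) x y

/-- By Zorn's lemma, a congruence that does not relate `x` and `y` lies below a maximal one.  A union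
of a chain of congruences is a congruence, because compatibility can be checked in one argument at a
time. -/
theorem exists_isMaxSeparating {α : Setoid M} (hα : IsCongruence L α) {x y : M} (h : ¬ α x y) :
    ∃ θ, α ≤ θ ∧ IsMaxSeparating L θ x y := by
  obtain ⟨θ, hαθ, hθ⟩ := zorn_le_nonempty₀ {θ : Setoid M | IsCongruence L θ ∧ ¬ θ x y}
    (fun c hc hchain θ₀ hθ₀ => by
      let σ : Setoid M :=
        { r := fun a b => ∃ θ ∈ c, θ a b
          iseqv :=
            { refl := fun a => ⟨θ₀, hθ₀, θ₀.refl a⟩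
              symm := fun ⟨θ, hθ, h⟩ => ⟨θ, hθ, θ.symm h⟩
              trans := by
                rintro a b d ⟨θ, hθ, h⟩ ⟨θ', hθ', h'⟩
                rcases hchain.total hθ hθ' with hle | hle
                · exact ⟨θ', hθ', θ'.trans (hle h) h'⟩
                · exact ⟨θ, hθ, θ.trans h (hle h')⟩ } }
      refine ⟨σ, ⟨isCongruence_of_update ?_, ?_⟩, fun θ hθ a b h => ⟨θ, hθ, h⟩⟩
      · rintro n f z i a b ⟨θ, hθ, h⟩
        exact ⟨θ, hθ, (hc hθ).1.update f z i h⟩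
      · rintro ⟨θ, hθ, h⟩
        exact (hc hθ).2 h) α ⟨hα, h⟩
  refine ⟨θ, hαθ, hθ.prop.1, hθ.prop.2, fun β hβ hle => ?_⟩
  by_contra hn
  exact hle (le_sup_right.trans (hθ.le_of_ge ⟨hθ.prop.1.sup hβ, hn⟩ le_sup_left))

/-- The congruences of the algebra satisfy the distributive law. -/
def CongruenceDistributive (L : FirstOrder.Language.{u, v}) (M : Type w) [L.Structure M] : Prop :=
  ∀ γ δ ε : Setoid M, IsCongruence L γ → IsCongruence L δ → IsCongruence L ε →
    γ ⊓ (δ ⊔ ε) ≤ (γ ⊓ δ) ⊔ (γ ⊓ ε)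

theorem congruenceDistributive_of_jonsson {n k : ℕ} {p : Fin (k + 1) → L.Term (Fin n ⊕ Fin 3)}
    {c : Fin n → M} (hp : JonssonIdentities fun i => polyOp (p i) c) :
    CongruenceDistributive L M := by
  intro γ δ ε hγ hδ hε
  have h1 : ∀ θ : Setoid M, IsCongruence L θ → ∀ i x y {u v}, θ u v →
      θ (polyOp (p i) c x u y) (polyOp (p i) c x v y) := by
    intro θ hθ i x y u v huv
    refine hθ.realize_term _ ?_
    rintro (j | j)
    · exact θ.refl _
    · fin_cases j
      exacts [θ.refl _, huv, θ.refl _]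
  have h2 : ∀ i x z {u v}, γ u v → γ (polyOp (p i) c x z u) (polyOp (p i) c x z v) := by
    intro i x z u v huv
    refine hγ.realize_term _ ?_
    rintro (j | j)
    · exact γ.refl _
    · fin_cases j
      exacts [γ.refl _, γ.refl _, huv]
  exact hp.inf_sup_le h2 (h1 δ hδ) (h1 ε hε)

theorem IsMaxSeparating.le_or_le (hM : CongruenceDistributive L M) {θ : Setoid M} {x y : M}
    (hθ : IsMaxSeparating L θ x y) {α β : Setoid M} (hα : IsCongruence L α)
    (hβ : IsCongruence L β) (h : α ⊓ β ≤ θ) : α ≤ θ ∨ β ≤ θ := by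
  by_contra! hn
  have hx := hθ.rel_of_not_le α hα hn.1
  have hy := hθ.rel_of_not_le β hβ hn.2
  have hθ' := hθ.isCongruence
  -- `(θ ⊔ α) ⊓ (θ ⊔ β) ≤ θ` by distributivity
  have h1 := hM (θ ⊔ α) θ β (hθ'.sup hα) hθ' hβ ⟨hx, hy⟩
  have h2 : (θ ⊔ α) ⊓ β ≤ θ := by
    rw [inf_comm]
    refine (hM β θ α hβ hθ' hα).trans (sup_le inf_le_right ?_)
    rwa [inf_comm]
  exact hθ.not_rel (sup_le inf_le_right h2 h1)

/-- Maximal separating congruences are meet-prime among the congruences. -/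
theorem IsMaxSeparating.exists_le_of_sInf_le (hM : CongruenceDistributive L M) {θ : Setoid M}
    {x y : M} (hθ : IsMaxSeparating L θ x y) {S : Set (Setoid M)} (hfin : S.Finite)
    (hS : ∀ α ∈ S, IsCongruence L α) (h : sInf S ≤ θ) : ∃ α ∈ S, α ≤ θ := by
  induction S, hfin using Set.Finite.induction_on with
  | empty =>
    rw [sInf_empty, top_le_iff] at h
    exact absurd (h ▸ trivial : θ x y) hθ.not_rel
  | @insert α S _ _ ih =>
    rw [sInf_insert] at h
    have hS' : ∀ β ∈ S, IsCongruence L β := fun β hβ => hS β (Set.mem_insert_of_mem _ hβ)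
    rcases hθ.le_or_le hM (hS α (Set.mem_insert _ _)) (IsCongruence.sInf hS') h with h' | h'
    · exact ⟨α, Set.mem_insert _ _, h'⟩
    · obtain ⟨β, hβ, hle⟩ := ih hS' h'
      exact ⟨β, Set.mem_insert_of_mem _ hβ, hle⟩

/-- In a finite congruence distributive algebra a maximal separating congruence `θ` has a conjugate:
a pair outside `θ` that lies in every congruence not below `θ`. -/
theorem IsMaxSeparating.exists_conjugate [Finite M] (hM : CongruenceDistributive L M)
    {θ : Setoid M} {x y : M} (hθ : IsMaxSeparating L θ x y) :
    ∃ c d : M, ¬ θ c d ∧ ∀ α : Setoid M, IsCongruence L α → ¬ α c d → α ≤ θ := by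
  have : Finite (Setoid M) :=
    Finite.of_injective (fun s : Setoid M => s.r) fun s t h => Setoid.ext fun a b => by
      exact iff_of_eq (congrFun (congrFun h a) b)
  have hn : ¬ sInf {α : Setoid M | IsCongruence L α ∧ ¬ α ≤ θ} ≤ θ := fun h => by
    obtain ⟨α, hα, hle⟩ := hθ.exists_le_of_sInf_le hM (Set.toFinite _) (fun α hα => hα.1) h
    exact hα.2 hle
  rw [Setoid.le_def] at hn
  push Not at hn
  obtain ⟨c, d, hcd, hθcd⟩ := hn
  refine ⟨c, d, hθcd, fun α hα hαcd => ?_⟩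
  by_contra hle
  exact hαcd (hcd α ⟨hα, hle⟩)

/-- If the homomorphism `φ` meets every class of `η`, then the congruences above the restriction of
`η` along `φ` are restrictions of congruences above `η`. -/
theorem exists_extension {D : Type*} [L.Structure D] (φ : D →[L] M) {η : Setoid M}
    (hη : IsCongruence L η) (hsurj : ∀ b : M, ∃ d : D, η b (φ d)) {α : Setoid D}
    (hα : IsCongruence L α) (hle : η.comap φ ≤ α) :
    ∃ β : Setoid M, IsCongruence L β ∧ η ≤ β ∧ β.comap φ = α := by
  choose g hg using hsurj
  have hgφ : ∀ d, α (g (φ d)) d := fun d => hle (η.symm (hg (φ d)))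
  refine ⟨α.comap g, ?_, ?_, ?_⟩
  · intro n f x y h
    have hx : ∀ x : Fin n → M, α (g (Structure.funMap f x)) (Structure.funMap f (g ∘ x)) := by
      intro x
      refine hle ?_
      change η (φ _) (φ _)
      rw [φ.map_fun]
      exact η.trans (η.symm (hg _)) (hη n f _ _ fun i => hg (x i))
    exact α.trans (hx x) (α.trans (hα n f _ _ h) (α.symm (hx y)))
  · intro a b hab
    exact hle (η.trans (η.symm (hg a)) (η.trans hab (hg b)))
  · refine Setoid.ext fun a b => ?_
    change α (g (φ a)) (g (φ b)) ↔ α a b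
    exact ⟨fun h => α.trans (α.symm (hgφ a)) (α.trans h (hgφ b)),
      fun h => α.trans (hgφ a) (α.trans h (α.symm (hgφ b)))⟩

theorem IsMaxSeparating.comap {D : Type*} [L.Structure D] (φ : D →[L] M) {η : Setoid M} {x y : D}
    (hη : IsMaxSeparating L η (φ x) (φ y)) (hsurj : ∀ b : M, ∃ d : D, η b (φ d)) :
    IsMaxSeparating L (η.comap φ) x y := by
  have hc := isCongruence_comap φ hη.isCongruence
  refine ⟨hc, hη.not_rel, fun α hα hle => ?_⟩
  obtain ⟨β, hβ, hηβ, hβα⟩ := exists_extension φ hη.isCongruence hsurj (hc.sup hα) le_sup_left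
  rw [← hβα]
  have h := hη.rel_of_not_le β hβ fun hβη => hle fun a b hab => by
    have : (β.comap φ) a b := by
      rw [hβα]
      exact (le_sup_right : α ≤ _) hab
    exact hβη this
  rwa [sup_eq_right.2 hηβ] at h

end Congruences

/-! ### Quotient algebras -/

section Quotients

variable {L : FirstOrder.Language.{u, v}} {M : Type w} [L.Structure M]

/-- The quotient of an algebra by a congruence.  The operations are computed on chosen
representatives; there are no relations to interpret, so these are set to be empty. -/
@[reducible] noncomputable def quotientStructure (L : FirstOrder.Language.{u, v}) {M : Type w}
    [L.Structure M] (θ : Setoid M) : L.Structure (Quotient θ) where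
  funMap f x := Quotient.mk θ (Structure.funMap f fun i => (x i).out)
  RelMap _ _ := False

/-- The canonical homomorphism from an algebra to its quotient by a congruence. -/
noncomputable def quotientHom [L.IsAlgebraic] {θ : Setoid M} (hθ : IsCongruence L θ) :
    letI := quotientStructure L θ
    M →[L] Quotient θ :=
  letI := quotientStructure L θ
  { toFun := Quotient.mk θ
    map_fun' := fun f x => Quotient.sound
      (hθ _ f _ _ fun i => θ.symm (Quotient.exact (Quotient.out_eq (Quotient.mk θ (x i)))))
    map_rel' := fun r _ => isEmptyElim r }

theorem quotient_realize [L.IsAlgebraic] {θ : Setoid M} (hθ : IsCongruence L θ) {α : Type*}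
    (t : L.Term α) (x : α → M) :
    letI := quotientStructure L θ
    t.realize (fun i => Quotient.mk θ (x i)) = Quotient.mk θ (t.realize x) := by
  let := quotientStructure L θ
  exact HomClass.realize_term (g := quotientHom hθ) (t := t) (v := x)

theorem IsMaxSeparating.isSubdirectlyIrreducible [L.IsAlgebraic] {θ : Setoid M} {x y : M}
    (hθ : IsMaxSeparating L θ x y) :
    letI := quotientStructure L θ
    IsSubdirectlyIrreducible L (Quotient θ) := by
  let := quotientStructure L θ
  let q := quotientHom hθ.isCongruence
  refine ⟨Cg L (q x) (q y), isCongruence_Cg _ _, fun h => ?_, fun α hα hne => Cg_le hα ?_⟩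
  · have h' := Cg_self (L := L) (q x) (q y)
    rw [h] at h'
    exact hθ.not_rel (Quotient.exact h')
  · have hle : θ ≤ α.comap q := fun a b hab => by
      have : q a = q b := Quotient.sound hab
      change α (q a) (q b)
      rw [this]
    have h := hθ.rel_of_not_le (α.comap q) (isCongruence_comap q hα) fun h => hne <| by
      rw [eq_bot_iff]
      intro a b
      induction a using Quotient.ind
      induction b using Quotient.ind
      intro hab
      exact Quotient.sound (h hab)
    rwa [sup_eq_right.2 hle] at h

end Quotients

/-! ### Varieties -/

section Varieties

variable {L : FirstOrder.Language.{u, v}} {E : Set (L.Term ℕ × L.Term ℕ)}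

/-- The algebra `M` is a member of the variety axiomatized by `E`. -/
abbrev InVariety (E : Set (L.Term ℕ × L.Term ℕ)) (M : Type w) [inst : L.Structure M] : Prop :=
  (⟨M, inst⟩ : Bundled.{w} L.Structure) ∈ variety E

theorem InVariety.quotient [L.IsAlgebraic] {M : Type w} [L.Structure M] (hM : InVariety E M)
    {θ : Setoid M} (hθ : IsCongruence L θ) :
    letI := quotientStructure L θ
    InVariety E (Quotient θ) := by
  let := quotientStructure L θ
  obtain ⟨⟨m⟩, h⟩ := hM
  refine ⟨⟨Quotient.mk θ m⟩, fun e he x => ?_⟩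
  have hx : x = fun i => Quotient.mk θ (x i).out := funext fun i => (Quotient.out_eq (x i)).symm
  change Term.realize x e.1 = Term.realize x e.2
  rw [hx, quotient_realize hθ, quotient_realize hθ]
  exact congrArg _ (h e he _)

theorem InVariety.substructure {M : Type w} [L.Structure M] (hM : InVariety E M)
    (S : L.Substructure M) (hS : Nonempty S) : InVariety E S := by
  refine ⟨hS, fun e he x => S.subtype.injective ?_⟩
  change S.subtype (e.1.realize x) = S.subtype (e.2.realize x)
  rw [← HomClass.realize_term S.subtype, ← HomClass.realize_term S.subtype]
  exact hM.2 e he _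

theorem IsMaxSeparating.card_quotient_lt [L.IsAlgebraic] {N : ℕ}
    (hN : IsResidualBound (variety.{u, v, w} E) (N : Cardinal)) {M : Type w} [L.Structure M]
    (hM : InVariety E M) {θ : Setoid M} {x y : M} (hθ : IsMaxSeparating L θ x y) :
    Finite (Quotient θ) ∧ Nat.card (Quotient θ) < N := by
  let := quotientStructure L θ
  have h : Cardinal.mk (Quotient θ) < N :=
    hN.1 _ (hM.quotient hθ.isCongruence) hθ.isSubdirectlyIrreducible
  have hfin : Finite (Quotient θ) :=
    Cardinal.lt_aleph0_iff_finite.1 (h.trans (Cardinal.natCast_lt_aleph0))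
  refine ⟨hfin, ?_⟩
  rwa [← Nat.cast_card, Nat.cast_lt] at h

/-! ### Finitely many terms -/

/-- The algebra of terms; there are no relations to interpret, so these are set to be empty. -/
@[reducible] def termStructure (L : FirstOrder.Language.{u, v}) (α : Type w) :
    L.Structure (L.Term α) where
  funMap f ts := Term.func f ts
  RelMap _ _ := False

theorem termStructure_realize {α β : Type*} (t : L.Term β) (x : β → L.Term α) :
    letI := termStructure L α
    t.realize x = t.subst x := by
  let := termStructure L α
  induction t with
  | var => rfl
  | func f ts ih => exact congrArg (Term.func f) (funext ih)

/-- In a locally finite variety there are, for every finite set `α` of variables, only finitely many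
terms up to equality in the variety, because the free algebra generated by `α` is finite. -/
theorem exists_finite_terms [L.IsAlgebraic]
    (hfin : LocallyFinite (variety.{u, v, max u w} E)) (α : Type) [Finite α] [Nonempty α] :
    ∃ T : Set (L.Term α), T.Finite ∧ ∀ t : L.Term α, ∃ t' ∈ T,
      ∀ (M : Type (max u w)) [L.Structure M], InVariety E M → ∀ x : α → M,
        t.realize x = t'.realize x := by
  -- the variables are lifted, so that the free algebra lies in the universe of the variety
  let β := ULift.{w} α
  let := termStructure L β
  let θ : Setoid (L.Term β) :=
    { r := fun s t => ∀ (M : Type (max u w)) [L.Structure M], InVariety E M → ∀ x : β → M,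
        s.realize x = t.realize x
      iseqv :=
        { refl := fun s M _ _ x => rfl
          symm := fun h M _ hM x => (h M hM x).symm
          trans := fun h h' M _ hM x => (h M hM x).trans (h' M hM x) } }
  have hθ : IsCongruence L θ := fun n f s t h M _ hM x =>
    congrArg (Structure.funMap f) (funext fun i => h i M hM x)
  let := quotientStructure L θ
  have hF : InVariety.{u, v, max u w} E (Quotient θ) := by
    refine ⟨⟨Quotient.mk θ (Term.var (Classical.arbitrary β))⟩, fun e he x => ?_⟩
    have hx : x = fun i => Quotient.mk θ (x i).out :=
      funext fun i => (Quotient.out_eq (x i)).symm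
    change Term.realize x e.1 = Term.realize x e.2
    rw [hx, quotient_realize hθ, quotient_realize hθ, termStructure_realize,
      termStructure_realize]
    refine Quotient.sound fun M _ hM y => ?_
    rw [Term.realize_subst, Term.realize_subst]
    exact hM.2 e he _
  have hgen : Substructure.closure L
      (Set.range fun i : β => Quotient.mk θ (Term.var i)) = (⊤ : L.Substructure (Quotient θ)) := by
    refine eq_top_iff.2 fun q _ => ?_
    induction q using Quotient.ind with
    | _ t =>
      have ht : Quotient.mk θ t = t.realize fun i => Quotient.mk θ (Term.var i) := by
        rw [quotient_realize hθ, termStructure_realize]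
        congr 1
        induction t with
        | var => rfl
        | func f ts ih => exact congrArg (Term.func f) (funext fun i => ih i trivial)
      rw [ht]
      exact Term.realize_mem _ _ fun i =>
        Substructure.subset_closure (Set.mem_range_self i)
  have hfinF : Finite (Quotient θ) := by
    have h := hfin _ hF ⊤ (hgen ▸ Substructure.fg_closure (Set.finite_range _))
    exact Finite.of_injective (fun q => (⟨q, trivial⟩ : (⊤ : L.Substructure (Quotient θ))))
      fun a b h => congrArg Subtype.val h
  refine ⟨Set.range fun q : Quotient θ => q.out.relabel ULift.down, Set.finite_range _,
    fun t => ⟨_, Set.mem_range_self (Quotient.mk θ (t.relabel ULift.up)), fun M _ hM x => ?_⟩⟩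
  have h : θ (Quotient.mk θ (t.relabel ULift.up)).out (t.relabel ULift.up) :=
    Quotient.exact (Quotient.out_eq _)
  have h' := h M hM (x ∘ ULift.down)
  rw [Term.realize_relabel] at h'
  rw [Term.realize_relabel, h']
  rfl

end Varieties

/-! ### Congruence formulas -/

section Schemes

variable {L : FirstOrder.Language.{u, v}}

/-- The condition that the congruence scheme `S` expresses about `w = r`, `x = s`, `y = a`,
`z = b`. -/
def CongruenceScheme.Holds (S : CongruenceScheme L) {M : Type w} [L.Structure M]
    (r s a b : M) : Prop :=
  ∃ (e : Fin S.numParams → M) (c : Fin (S.length + 1) → M), c 0 = r ∧ c (Fin.last _) = s ∧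
    ∀ i, ((S.term i).realize (Sum.elim e fun _ => a) = c i.castSucc ∧
        (S.term i).realize (Sum.elim e fun _ => b) = c i.succ) ∨
      ((S.term i).realize (Sum.elim e fun _ => a) = c i.succ ∧
        (S.term i).realize (Sum.elim e fun _ => b) = c i.castSucc)

theorem CongruenceScheme.realize_toFormula (S : CongruenceScheme L) {M : Type w} [L.Structure M]
    (r s a b : M) : S.toFormula.Realize ![r, s, a, b] ↔ S.Holds r s a b := by
  have hterm : ∀ (e : Fin S.numParams ⊕ Fin (S.length + 1) → M) (i : Fin S.length) (j : Fin 4),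
      (S.termAt i j).realize (Sum.elim ![r, s, a, b] e) =
        (S.term i).realize (Sum.elim (e ∘ Sum.inl) fun _ => ![r, s, a, b] j) := by
    intro e i j
    rw [CongruenceScheme.termAt, Term.realize_relabel]
    congr 1
    funext x
    rcases x with x | x <;> rfl
  rw [CongruenceScheme.toFormula, Formula.realize_iExs]
  simp only [Formula.realize_inf, Formula.realize_equal, Formula.realize_iInf,
    CongruenceScheme.link, Formula.realize_sup, hterm, CongruenceScheme.chainVar,
    Term.realize_var, Sum.elim_inl, Sum.elim_inr]
  constructor
  · rintro ⟨e, h⟩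
    exact ⟨e ∘ Sum.inl, e ∘ Sum.inr, h⟩
  · rintro ⟨e, c, h⟩
    exact ⟨Sum.elim e c, h⟩

theorem CongruenceScheme.Holds.cg {S : CongruenceScheme L} {M : Type w} [L.Structure M]
    {r s a b : M} (h : S.Holds r s a b) : Cg L a b r s := by
  obtain ⟨e, c, rfl, rfl, h⟩ := h
  have hstep : ∀ i, Cg L a b ((S.term i).realize (Sum.elim e fun _ => a))
      ((S.term i).realize (Sum.elim e fun _ => b)) := fun i =>
    (isCongruence_Cg a b).realize_term _ fun j => by
      rcases j with j | j
      · exact Setoid.refl' _ _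
      · exact Cg_self a b
  have hall : ∀ i, Cg L a b (c 0) (c i) := fun i => by
    induction i using Fin.induction with
    | zero => exact Setoid.refl' _ _
    | succ i ih =>
      refine Setoid.trans' _ ih ?_
      rcases h i with ⟨h1, h2⟩ | ⟨h1, h2⟩
      · rw [← h1, ← h2]
        exact hstep i
      · rw [← h1, ← h2]
        exact Setoid.symm' _ (hstep i)
  exact hall _

theorem CongruenceScheme.Holds.map {S : CongruenceScheme L} {M P : Type*} [L.Structure M]
    [L.Structure P] (φ : M →[L] P) {r s a b : M} (h : S.Holds r s a b) :
    S.Holds (φ r) (φ s) (φ a) (φ b) := by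
  obtain ⟨e, c, rfl, rfl, h⟩ := h
  have hφ : ∀ i x, (S.term i).realize (Sum.elim (φ ∘ e) fun _ => φ x) =
      φ ((S.term i).realize (Sum.elim e fun _ => x)) := fun i x => by
    rw [← HomClass.realize_term φ, Sum.comp_elim]
    rfl
  refine ⟨φ ∘ e, φ ∘ c, rfl, rfl, fun i => ?_⟩
  rw [hφ, hφ]
  exact (h i).imp (fun h => ⟨congrArg φ h.1, congrArg φ h.2⟩)
    fun h => ⟨congrArg φ h.1, congrArg φ h.2⟩

/-- Finitely many congruence schemes are combined into one congruence formula, their disjunction. -/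
theorem exists_isCongruenceFormula {C : Set (CongruenceScheme L)} (hC : C.Finite) :
    ∃ φ : L.Formula (Fin 4), IsCongruenceFormula φ ∧ ∀ (M : Type w) [L.Structure M]
      (r s a b : M), φ.Realize ![r, s, a, b] ↔ ∃ S ∈ C, S.Holds r s a b := by
  refine ⟨_, ⟨hC.toFinset.toList, rfl⟩, fun M _ r s a b => ?_⟩
  have h : ∀ l : List (CongruenceScheme L),
      (l.foldr (fun S χ => S.toFormula ⊔ χ) ⊥ : L.Formula (Fin 4)).Realize ![r, s, a, b] ↔
        ∃ S ∈ l, S.Holds r s a b := by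
    intro l
    induction l with
    | nil => simp
    | cons S l ih =>
      rw [List.foldr_cons, Formula.realize_sup, S.realize_toFormula, ih]
      simp
  rw [h]
  simp

/-- In an algebra with at most `m` elements that is generated by `g`, a principal congruence is
given by chains of length `m`, whose links are values of unary polynomials with parameters `g`, taken
from a set `T` that represents all terms.  A path in the graph of all links from `r` to `s` visits
every element at most once, whence the bound on the length. -/
theorem exists_chain_of_cg {M : Type w} [L.Structure M] [Finite M] {ι : Type*} {g : ι → M}
    (hg : ∀ x : M, ∃ t : L.Term ι, t.realize g = x) {T : Set (L.Term (ι ⊕ Unit))}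
    (hT : ∀ t : L.Term (ι ⊕ Unit), ∃ t' ∈ T, ∀ x : ι ⊕ Unit → M, t.realize x = t'.realize x)
    {m : ℕ} (hm : Nat.card M ≤ m) {a b r s : M} (h : Cg L a b r s) :
    ∃ (f : Fin m → T) (c : Fin (m + 1) → M), c 0 = r ∧ c (Fin.last _) = s ∧
      ∀ i, ((f i).1.realize (Sum.elim g fun _ => a) = c i.castSucc ∧
          (f i).1.realize (Sum.elim g fun _ => b) = c i.succ) ∨
        ((f i).1.realize (Sum.elim g fun _ => a) = c i.succ ∧
          (f i).1.realize (Sum.elim g fun _ => b) = c i.castSucc) := by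
  classical
  have := Fintype.ofFinite M
  let R : M → M → Prop := fun x y => ∃ t ∈ T, t.realize (Sum.elim g fun _ => a) = x ∧
    t.realize (Sum.elim g fun _ => b) = y
  -- the relation `R` consists of the values of all unary polynomials at `(a, b)`
  have hR : ∀ t : L.Term (ι ⊕ Unit),
      R (t.realize (Sum.elim g fun _ => a)) (t.realize (Sum.elim g fun _ => b)) := fun t => by
    obtain ⟨t', ht', h⟩ := hT t
    exact ⟨t', ht', (h _).symm, (h _).symm⟩
  have hconst : ∀ x, ∃ t : L.Term (ι ⊕ Unit), ∀ z, t.realize (Sum.elim g fun _ => z) = x :=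
    fun x => by
      obtain ⟨t, rfl⟩ := hg x
      exact ⟨t.relabel Sum.inl, fun z => by rw [Term.realize_relabel]; rfl⟩
  have hrefl : ∀ x, R x x := fun x => by
    obtain ⟨t, ht⟩ := hconst x
    simpa only [ht] using hR t
  have htrans : ∀ {n : ℕ} (f : L.Functions n) (x : Fin n → M) (i : Fin n) {y z : M}, R y z →
      R (Structure.funMap f (Function.update x i y))
        (Structure.funMap f (Function.update x i z)) := by
    rintro n f x i y z ⟨t, -, rfl, rfl⟩
    choose τ hτ using fun j => hconst (x j)
    have key : ∀ w, (Term.func f (Function.update τ i t)).realize (Sum.elim g fun _ => w) =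
        Structure.funMap f (Function.update x i (t.realize (Sum.elim g fun _ => w))) := by
      intro w
      rw [Term.realize]
      congr 1
      funext j
      rcases eq_or_ne j i with rfl | hj
      · simp
      · simp [hj, hτ]
    rw [← key, ← key]
    exact hR _
  let G : SimpleGraph M := SimpleGraph.fromRel R
  have hG : ∀ {x y}, R x y → G.Reachable x y := fun {x y} hxy => by
    rcases eq_or_ne x y with rfl | hne
    · exact SimpleGraph.Reachable.refl _
    · exact SimpleGraph.Adj.reachable ((SimpleGraph.fromRel_adj R x y).2 ⟨hne, Or.inl hxy⟩)
  have hcong : IsCongruence L G.reachableSetoid := by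
    refine isCongruence_of_update fun n f x i y z hyz => ?_
    obtain ⟨p⟩ := (hyz : G.Reachable y z)
    change G.Reachable _ _
    induction p with
    | nil => exact SimpleGraph.Reachable.refl _
    | cons hadj _ ih =>
      refine SimpleGraph.Reachable.trans ?_ ih
      rcases ((SimpleGraph.fromRel_adj R _ _).1 hadj).2 with h | h
      · exact hG (htrans f x i h)
      · exact (hG (htrans f x i h)).symm
  have hab : G.Reachable a b := hG (by simpa using hR (Term.var (Sum.inr ())))
  obtain ⟨p, hp⟩ := (Cg_le hcong hab h : G.Reachable r s).exists_isPath
  have hlen : p.length ≤ m := by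
    have := hp.length_lt
    rw [← Nat.card_eq_fintype_card] at this
    omega
  -- beyond the end of the path the chain is constant, which pads it to length `m`
  have hlink : ∀ i : ℕ, R (p.getVert i) (p.getVert (i + 1)) ∨
      R (p.getVert (i + 1)) (p.getVert i) := fun i => by
    rcases lt_or_ge i p.length with hi | hi
    · exact ((SimpleGraph.fromRel_adj R _ _).1 (p.adj_getVert_succ hi)).2
    · rw [p.getVert_of_length_le hi, p.getVert_of_length_le (hi.trans (Nat.le_succ i))]
      exact Or.inl (hrefl s)
  have hf : ∀ i : Fin m, ∃ t : T,
      (t.1.realize (Sum.elim g fun _ => a) = p.getVert i ∧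
          t.1.realize (Sum.elim g fun _ => b) = p.getVert (i + 1)) ∨
        (t.1.realize (Sum.elim g fun _ => a) = p.getVert (i + 1) ∧
          t.1.realize (Sum.elim g fun _ => b) = p.getVert i) := fun i => by
    rcases hlink i with ⟨t, ht, h⟩ | ⟨t, ht, h⟩
    · exact ⟨⟨t, ht⟩, Or.inl h⟩
    · exact ⟨⟨t, ht⟩, Or.inr h⟩
  choose f hf using hf
  exact ⟨f, fun i => p.getVert i, p.getVert_zero, p.getVert_of_length_le hlen, hf⟩

/-- The pair `(r, s)` lies in the principal congruence `Cg(a, b)` of the subalgebra `D`. -/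
def CgIn {M : Type w} [L.Structure M] (D : L.Substructure M) (a b r s : M) : Prop :=
  ∃ (ha : a ∈ D) (hb : b ∈ D) (hr : r ∈ D) (hs : s ∈ D),
    Cg L (⟨a, ha⟩ : D) ⟨b, hb⟩ ⟨r, hr⟩ ⟨s, hs⟩

theorem CgIn.cg {M : Type w} [L.Structure M] {D : L.Substructure M} {a b r s : M}
    (h : CgIn D a b r s) : Cg L a b r s := by
  obtain ⟨ha, hb, hr, hs, h⟩ := h
  exact Cg_map D.subtype.toHom h

/-- In a locally finite variety there is one congruence formula that describes the principal
congruences of all subalgebras with a given number of generators. -/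
theorem exists_congruenceFormula_of_generators [L.IsAlgebraic] {E : Set (L.Term ℕ × L.Term ℕ)}
    (hfin : LocallyFinite (variety.{u, v, max u w} E)) (ι : Type) [Finite ι] [Nonempty ι] :
    ∃ φ : L.Formula (Fin 4), IsCongruenceFormula φ ∧
      ∀ (M : Type (max u w)) [L.Structure M], InVariety E M → ∀ a b r s : M,
        (φ.Realize ![r, s, a, b] → Cg L a b r s) ∧
        ∀ g : ι → M, CgIn (Substructure.closure L (Set.range g)) a b r s →
          φ.Realize ![r, s, a, b] := by
  obtain ⟨n, ⟨e⟩⟩ := Finite.exists_equiv_fin ι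
  have : Nonempty (Fin n) := e.symm.nonempty
  obtain ⟨T₀, hT₀, hT₀'⟩ := exists_finite_terms.{u, v, w} hfin (Fin n)
  obtain ⟨T, hT, hT'⟩ := exists_finite_terms.{u, v, w} hfin (Fin n ⊕ Unit)
  have := hT.to_subtype
  have := hT₀.to_subtype
  let scheme : (Fin (Nat.card T₀) → T) → CongruenceScheme L := fun f => ⟨n, _, fun i => f i⟩
  obtain ⟨φ, hφ, h⟩ := exists_isCongruenceFormula.{u, v, max u w} (Set.finite_range scheme)
  refine ⟨φ, hφ, fun M _ hM a b r s => ⟨fun hr => ?_, fun g hr => ?_⟩⟩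
  · obtain ⟨S, -, hS⟩ := (h M r s a b).1 hr
    exact hS.cg
  rw [← e.symm.surjective.range_comp] at hr
  set D := Substructure.closure L (Set.range (g ∘ e.symm)) with hD
  obtain ⟨ha, hb, hr, hs, hcg⟩ := hr
  let gD : Fin n → D := fun i => ⟨_, Substructure.subset_closure (Set.mem_range_self i)⟩
  have hgen : ∀ x : D, ∃ t : L.Term (Fin n), t.realize gD = x := by
    rintro ⟨x, hx⟩
    obtain ⟨t, ht⟩ := Substructure.mem_closure_iff_exists_term.1 hx
    choose j hj using fun y : Set.range (g ∘ e.symm) => y.2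
    refine ⟨t.relabel j, D.subtype.injective ?_⟩
    rw [← HomClass.realize_term D.subtype, Term.realize_relabel]
    refine Eq.trans ?_ ht
    congr 1
    funext y
    exact hj y
  have hDV : InVariety.{u, v, max u w} E D := hM.substructure D ⟨⟨a, ha⟩⟩
  have hsurj : Function.Surjective fun t : T₀ => t.1.realize gD := fun x => by
    obtain ⟨t, ht⟩ := hgen x
    obtain ⟨t', ht', heq⟩ := hT₀' t
    exact ⟨⟨t', ht'⟩, (heq D hDV gD).symm.trans ht⟩
  have hfinD : Finite D := Finite.of_surjective _ hsurj
  obtain ⟨f, c, h0, h1, hc⟩ := exists_chain_of_cg hgen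
    (fun t => (hT' t).imp fun t' ht' => ⟨ht'.1, ht'.2 D hDV⟩)
    (Nat.card_le_card_of_surjective _ hsurj) hcg
  have hS : (scheme f).Holds (⟨r, hr⟩ : D) ⟨s, hs⟩ ⟨a, ha⟩ ⟨b, hb⟩ := ⟨gD, c, h0, h1, hc⟩
  exact (h M r s a b).2 ⟨_, Set.mem_range_self f, hS.map D.subtype.toHom⟩

end Schemes

/-! ### Pairs with uniformly generated principal congruences -/

section Main

variable {L : FirstOrder.Language.{u, v}} {M : Type w} [L.Structure M]

/-- The Jónsson identities pass to subalgebras that contain the constants. -/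
theorem CongruenceDistributive.of_jonsson_substructure {n k : ℕ}
    {p : Fin (k + 1) → L.Term (Fin n ⊕ Fin 3)} {c : Fin n → M}
    (hp : JonssonIdentities fun i => polyOp (p i) c) (D : L.Substructure M)
    (hc : ∀ i, c i ∈ D) : CongruenceDistributive L D := by
  have hval : ∀ i (x y z : D), ((polyOp (p i) (fun j => (⟨c j, hc j⟩ : D)) x y z : D) : M) =
      polyOp (p i) c x y z := by
    intro i x y z
    change D.subtype _ = _
    rw [polyOp, polyOp, ← HomClass.realize_term D.subtype]
    congr 1
    funext j
    rcases j with j | j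
    · rfl
    · fin_cases j <;> rfl
  refine congruenceDistributive_of_jonsson (p := p) (c := fun j => (⟨c j, hc j⟩ : D))
    ⟨fun x y z => ?_, fun x y z => ?_, fun i x y => ?_, fun i hi x y => ?_, fun i hi x y => ?_⟩ <;>
    apply Subtype.ext <;> simp only [hval]
  exacts [hp.first _ _ _, hp.last _ _ _, hp.absorb _ _ _, hp.even i hi _ _, hp.odd i hi _ _]

/-- If the subalgebra `D` meets every class of each maximal separating congruence that separates
`c` and `d`, then `Cg(c, d)` can be computed in every finite subalgebra above `D`. -/
theorem cgIn_of_forall_surjective {D' : L.Substructure M} [Finite D']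
    (hD' : CongruenceDistributive L D') {c d : M} (hc : c ∈ D') (hd : d ∈ D')
    (hsurj : ∀ (η : Setoid M) (x y : M), IsMaxSeparating L η x y → ¬ η c d →
      ∀ b : M, ∃ e : D', η b e)
    {r s : M} (hr : r ∈ D') (hs : s ∈ D') (hrs : Cg L c d r s) : CgIn D' c d r s := by
  refine ⟨hc, hd, hr, hs, ?_⟩
  by_contra hn
  obtain ⟨θ, hle, hθ⟩ := exists_isMaxSeparating (isCongruence_Cg _ _) hn
  let φ : D' →[L] M := D'.subtype.toHom
  have : Finite (Setoid D') :=
    Finite.of_injective (fun s : Setoid D' => s.r) fun s t h => Setoid.ext fun a b => by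
      exact iff_of_eq (congrFun (congrFun h a) b)
  -- the restrictions of the maximal separating congruences of `M` meet in equality
  let S : Set (Setoid D') := {α | ∃ η x y, IsMaxSeparating L η x y ∧ α = η.comap φ}
  obtain ⟨α, ⟨η, x, y, hη, rfl⟩, hαθ⟩ : ∃ α ∈ S, α ≤ θ := by
    refine hθ.exists_le_of_sInf_le hD' (Set.toFinite S) ?_ ?_
    · rintro _ ⟨η, x, y, hη, rfl⟩
      exact isCongruence_comap φ hη.isCongruence
    · intro a b hab
      have hab' : a = b := by
        by_contra hne
        obtain ⟨η, -, hη⟩ := exists_isMaxSeparating (L := L) (α := (⊥ : Setoid M))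
          IsCongruence.bot (x := (a : M)) (y := b) fun h => hne (Subtype.ext h)
        exact hη.not_rel (hab _ ⟨η, a, b, hη, rfl⟩)
      rw [hab']
  have hcd : ¬ η c d := fun h => hθ.not_rel (hαθ (Cg_le hη.isCongruence h hrs))
  -- `θ` is the restriction of a congruence of `M`, and this relates `c` and `d`
  obtain ⟨β, hβ, -, hβθ⟩ :=
    exists_extension φ hη.isCongruence (hsurj η x y hη hcd) hθ.isCongruence hαθ
  have hβcd : (β.comap φ) ⟨c, hc⟩ ⟨d, hd⟩ := by
    rw [hβθ]
    exact hle (Cg_self _ _)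
  have hβrs : (β.comap φ) ⟨r, hr⟩ ⟨s, hs⟩ := Cg_le hβ (by exact hβcd) hrs
  rw [hβθ] at hβrs
  exact hθ.not_rel hβrs

/-- Every pair `a ≠ b` admits a pair `c ≠ d` in `Cg(a, b)` whose principal congruence can be
computed in subalgebras with boundedly many generators.  Among the maximal separating congruences
`η` with `(a, b) ∉ η` one with a quotient of largest cardinality is chosen.  The subalgebra `D` contains
`a`, `b` and representatives of all classes of `η`, and `(c, d)` is conjugate to the restriction of
`η` to `D`. -/
theorem exists_pair_cgIn [L.IsAlgebraic] {E : Set (L.Term ℕ × L.Term ℕ)}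
    (hfin : LocallyFinite (variety.{u, v, w} E)) {N : ℕ}
    (hN : IsResidualBound (variety.{u, v, w} E) (N : Cardinal)) (hM : InVariety E M) {n k : ℕ}
    {p : Fin (k + 1) → L.Term (Fin n ⊕ Fin 3)} {e : Fin n → M}
    (hp : JonssonIdentities fun i => polyOp (p i) e) {a b : M} (hab : a ≠ b) :
    ∃ (g : Fin n ⊕ Fin N ⊕ Fin 4 → M) (c d : M), c ≠ d ∧
      CgIn (Substructure.closure L (Set.range g)) a b c d ∧
      ∀ r s, Cg L c d r s →
        CgIn (Substructure.closure L (Set.range (Sum.elim g ![r, s]))) c d r s := by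
  let I : Set (Setoid M) := {η | ∃ x y, IsMaxSeparating L η x y ∧ ¬ η a b}
  have hI : I.Nonempty := by
    obtain ⟨η, -, hη⟩ := exists_isMaxSeparating (L := L) (α := (⊥ : Setoid M))
      IsCongruence.bot (x := a) (y := b) hab
    exact ⟨η, a, b, hη, hη.not_rel⟩
  have hIfin : ((fun η : Setoid M => Nat.card (Quotient η)) '' I).Finite := by
    refine (Set.finite_lt_nat N).subset ?_
    rintro _ ⟨η, ⟨x, y, hη, -⟩, rfl⟩
    exact (hη.card_quotient_lt hN hM).2
  obtain ⟨_, ⟨η, ⟨x, y, hη, hηab⟩, rfl⟩, hmax⟩ :=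
    Set.exists_max_image _ id hIfin (hI.image _)
  obtain ⟨hQ, hlt⟩ := hη.card_quotient_lt hN hM
  obtain ⟨q, hq⟩ : ∃ q : Fin N → M, ∀ z, ∃ i, η z (q i) := by
    let f := Finite.equivFin (Quotient η)
    refine ⟨fun i => if h : i.1 < Nat.card (Quotient η) then (f.symm ⟨i, h⟩).out else a,
      fun z => ⟨⟨f (Quotient.mk η z), (f _).2.trans hlt⟩, ?_⟩⟩
    simp only [Fin.is_lt, Fin.eta, dite_true, Equiv.symm_apply_apply]
    exact η.symm (Quotient.exact (Quotient.out_eq _))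
  let g : Fin n ⊕ Fin N ⊕ Fin 4 → M := Sum.elim e (Sum.elim q ![x, y, a, b])
  set D := Substructure.closure L (Set.range g) with hD
  have hgD : ∀ i, g i ∈ D := fun i => Substructure.subset_closure (Set.mem_range_self i)
  have hx : x ∈ D := hgD (Sum.inr (Sum.inr 0))
  have hy : y ∈ D := hgD (Sum.inr (Sum.inr 1))
  have ha : a ∈ D := hgD (Sum.inr (Sum.inr 2))
  have hb : b ∈ D := hgD (Sum.inr (Sum.inr 3))
  have hDfin : Finite D := hfin _ hM D (Substructure.fg_closure (Set.finite_range _))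
  let φ : D →[L] M := D.subtype.toHom
  have hsurj : ∀ z : M, ∃ z' : D, η z (φ z') := fun z => by
    obtain ⟨i, hi⟩ := hq z
    exact ⟨⟨q i, hgD (Sum.inr (Sum.inl i))⟩, hi⟩
  have hθ : IsMaxSeparating L (η.comap φ) (⟨x, hx⟩ : D) ⟨y, hy⟩ :=
    IsMaxSeparating.comap φ hη hsurj
  obtain ⟨c, d, hcd, hconj⟩ := hθ.exists_conjugate
    (CongruenceDistributive.of_jonsson_substructure hp D fun i => hgD (Sum.inl i))
  have habcd : Cg L (⟨a, ha⟩ : D) ⟨b, hb⟩ c d := by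
    by_contra hn
    exact hηab (hconj _ (isCongruence_Cg _ _) hn (Cg_self _ _))
  refine ⟨g, c, d, fun h => hcd (by rw [Subtype.ext h]), ⟨ha, hb, c.2, d.2, habcd⟩,
    fun r s hrs => ?_⟩
  -- by the maximal choice of `η`, the subalgebra `D` maps onto every quotient separating `c`, `d`
  have hsurj' : ∀ (η' : Setoid M) (x y : M), IsMaxSeparating L η' x y → ¬ η' c d →
      ∀ z : M, ∃ z' : D, η' z (φ z') := by
    intro η' x' y' hη' hcd' z
    have hle : η'.comap φ ≤ η.comap φ :=
      hconj _ (isCongruence_comap φ hη'.isCongruence) hcd'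
    have hab' : ¬ η' a b := fun h =>
      hcd' (Cg_le (θ := η'.comap φ) (isCongruence_comap φ hη'.isCongruence) h habcd)
    have hcard : Nat.card (Quotient η') ≤ Nat.card (Quotient η) :=
      hmax _ ⟨η', ⟨x', y', hη', hab'⟩, rfl⟩
    obtain ⟨hQ', -⟩ := hη'.card_quotient_lt hN hM
    choose ρ hρ using hsurj
    let F : Quotient η → Quotient η' := fun t => Quotient.mk η' (φ (ρ t.out))
    have hF : Function.Injective F := fun t t' h => by
      have h0 : η' (φ (ρ t.out)) (φ (ρ t'.out)) := Quotient.exact h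
      have h1 : η (φ (ρ t.out)) (φ (ρ t'.out)) := hle h0
      rw [← Quotient.out_eq t, ← Quotient.out_eq t']
      exact Quotient.sound (η.trans (hρ _) (η.trans h1 (η.symm (hρ _))))
    obtain ⟨t, ht⟩ := (hF.bijective_of_nat_card_le hcard).2 (Quotient.mk η' z)
    exact ⟨ρ t.out, η'.symm (Quotient.exact ht)⟩
  set D' := Substructure.closure L (Set.range (Sum.elim g ![r, s])) with hD'
  have hDD' : D ≤ D' := Substructure.closure_mono (by
    rintro _ ⟨i, rfl⟩
    exact ⟨Sum.inl i, rfl⟩)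
  have hrD : r ∈ D' := Substructure.subset_closure ⟨Sum.inr 0, rfl⟩
  have hsD : s ∈ D' := Substructure.subset_closure ⟨Sum.inr 1, rfl⟩
  have hDfin' : Finite D' := hfin _ hM D' (Substructure.fg_closure (Set.finite_range _))
  refine cgIn_of_forall_surjective
    (CongruenceDistributive.of_jonsson_substructure hp D' fun i => hDD' (hgD (Sum.inl i)))
    (hDD' c.2) (hDD' d.2) (fun η' x' y' hη' hcd' z => ?_) hrD hsD hrs
  obtain ⟨z', hz'⟩ := hsurj' η' x' y' hη' hcd' z
  exact ⟨⟨z', hDD' z'.2⟩, hz'⟩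

end Main

end UnivAlg

theorem mainTheorem7 (L : FirstOrder.Language.{u, v}) [L.IsAlgebraic]
    (E : Set (L.Term ℕ × L.Term ℕ))
    (hfin : UnivAlg.LocallyFinite (UnivAlg.variety.{u, v, max u w} E))
    (N : ℕ) (hN : UnivAlg.IsResidualBound (UnivAlg.variety.{u, v, max u w} E) (N : Cardinal))
    (n k : ℕ) (p : Fin (k + 1) → L.Term (Fin n ⊕ Fin 3)) :
    UnivAlg.HasDPSC (UnivAlg.jonssonClass (UnivAlg.variety.{u, v, max u w} E) p) := by
  obtain ⟨Γ, hΓ, hΓ'⟩ :=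
    UnivAlg.exists_congruenceFormula_of_generators.{u, v, w} hfin (Fin n ⊕ Fin N ⊕ Fin 4)
  obtain ⟨ψ, hψ, hψ'⟩ := UnivAlg.exists_congruenceFormula_of_generators.{u, v, w} hfin
    ((Fin n ⊕ Fin N ⊕ Fin 4) ⊕ Fin 2)
  refine ⟨Γ, ψ, hΓ, hψ, fun A hA a b hab => ?_⟩
  obtain ⟨hAV, e, hp⟩ := hA
  obtain ⟨g, c, d, hcd, habcd, hrs⟩ := UnivAlg.exists_pair_cgIn hfin hN hAV hp hab
  exact ⟨c, d, hcd, (hΓ' A hAV a b c d).2 g habcd, fun r s =>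
    ⟨(hψ' A hAV c d r s).1, fun h => (hψ' A hAV c d r s).2 _ (hrs r s h)⟩⟩
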